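/- **Setting.** For every $K$ consider a downlink with $K$ single-antenna users and a base station with $M=M_K>K$ antennas. Let $a_0,\rho_t,\sigma_n,A_{\mathrm{sat}}>0$ (base-station amplifier gain, transmit power, noise standard deviation, saturation level). Antenna $m$ has relative saturation level $a_m>0$, transmit factor $t_m\in\mathbb C$ and receive gain $r_m\in\mathbb C\setminus\{0\}$; these are otherwise arbitrary (possibly random) sequences. User $k$ has path loss $\phi_k\in[\phi_{\min},\phi_{\max}]$ with $0<\phi_{\min}\le\phi_{\max}$ fixed, receive gain $u_k\in\mathbb C$ and relative transmit gain $b_k=v_k\bigl(1+(|x_k|/B_k)^{2p}\bigr)^{-1/(2p)}$, where $p>0$, $v_k\in\mathbb C\setminus\{0\}$, $x_k\in\mathbb C$ is the user's uplink signal and $B_k>0$ its saturation level. The $|u_k|$ are independent with $\ln|u_k|\sim\mathcal N(0,\delta_u^2)$, and the $|b_k|$ are independent and identically distributed with $\mathbb E|b_k|^{-2}<\infty$ (nothing is assumed on the joint law of the two families). Put $\mathbf R=\mathrm{diag}(r_1,\dots,r_M)$, $\mathcal B=\mathrm{diag}(b_1,\dots,b_K)$, $\mathbf\Phi=\mathrm{diag}(\phi_1,\dots,\phi_K)$,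 $\mathbf G=\mathrm{diag}(g_1,\dots,g_M)$ and $\mathbf\Sigma=\mathrm{diag}(\sigma_1^2,\dots,\sigma_M^2)$, where, with $A_m=A_{\mathrm{sat}}a_m$ and $s_m=\sqrt{|r_m|^2\rho_t/\mathrm{tr}\{\mathbf R\mathbf R^*\}}$, $$g_m=t_m\,\mu(A_m/s_m),\qquad \mu(x)=\tfrac x2\bigl[2x-\sqrt\pi\,\mathrm{erfc}(x)e^{x^2}(2x^2-1)\bigr],$$ $$\sigma_m^2=|t_m|^2\Bigl[A_m^2+\tfrac{A_m^4}{s_m^2}e^{A_m^2/s_m^2}\mathrm{Ei}\bigl(-\tfrac{A_m^2}{s_m^2}\bigr)-s_m^2\,\mu(A_m/s_m)^2\Bigr],\qquad \mathrm{Ei}(x)=\int_{-\infty}^x\tfrac{e^s}{s}\,ds .$$ Let $\alpha=\frac1M\mathrm{tr}\{\mathbf R^{-1}\mathbf G\}$, $T=\mathrm{tr}\{(\mathbf G-\alpha\mathbf R)(\mathbf G-\alpha\mathbf R)^*\}$, $\varepsilon_2=T/M$, $\beta=\mathrm{tr}\{(\mathcal B\mathbf\Phi^2\mathcal B^*)^{-1}\}$.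 The (closed-form, zero-forcing) SINDR of user $k$ is $\gamma_k=\Upsilon^{\mathrm{ES}}_k/(\Upsilon^{\mathrm{SI}}_k+\Upsilon^{\mathrm{MUI}}_k+\Upsilon^{\mathrm{NLD}}_k+\sigma_n^2)$ with $$\Upsilon^{\mathrm{ES}}_k=\frac{a_0\rho_t(M-K)\,|u_k\mathrm{tr}\{\mathbf G\mathbf R^*\}|^2}{M|b_k|^2\,\beta\,\mathrm{tr}\{\mathbf R\mathbf R^*\}},\qquad \Upsilon^{\mathrm{SI}}_k=\frac{a_0\rho_t(M-K)|u_k|^2\,T}{M^2|b_k|^2\,\beta},$$ $$\Upsilon^{\mathrm{MUI}}_k=\sum_{i\ne k}\frac{a_0\rho_t(M-K)\phi_k^2\,T}{M^2|u_k^{-1}b_i|^2\phi_i^2\,\beta},\qquad \Upsilon^{\mathrm{NLD}}_k=a_0|u_k|^2\phi_k^2\,\mathrm{tr}\{\mathbf\Sigma\}.$$ The average achievable rate is $R=\frac1K\sum_{k=1}^K\log(1+\gamma_k)$; put $\widetilde R=\frac1K\sum_{k=1}^K\log\gamma_k$. Further let $$R_{\mathrm{Ideal}}=\log\Bigl(\frac{M-K}{\mathrm{tr}\{\mathbf\Phi^{-2}\}}\cdot\frac{\rho_ta_0}{\sigma_n^2}\Bigr),\qquad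 \Delta R_{\mathrm{UE}}=\frac1K\sum_{k=1}^K\log\Bigl(\frac{|b_k|^2}{K|u_k|^2}\,\mathrm{tr}\{(\mathcal B\mathcal B^*)^{-1}\}\Bigr),$$ $$\Delta R_{\mathrm{BS}}=\frac1K\sum_{k=1}^K\log\Biggl(\frac{\frac{M-K}{M}\rho_ta_0\phi_k^2\varepsilon_2+\sigma_{\mathrm{eq},k}^2}{\frac1M\sigma_n^2\,|\mathrm{tr}\{\mathbf G\mathbf R^*\}|^2\,(\mathrm{tr}\{\mathbf R\mathbf R^*\})^{-1}}\Biggr),\qquad \sigma_{\mathrm{eq},k}^2=a_0\phi_k^2\,\mathrm{tr}\{\mathbf\Sigma\}+\frac{\sigma_n^2}{|u_k|^2}.$$ **Claim.** $R=R_{\mathrm{Ideal}}-\Delta R_{\mathrm{BS}}-\Delta R_{\mathrm{UE}}$ up to the error of replacing $\log(1+\gamma_k)$ by $\log\gamma_k$ and an error that vanishes as $K\to\infty$. Precisely: 1. For every $K\ge1$ and every realization with $\gamma_k>1$ for all $k\le K$: $\;0<R-\widetilde R<\log 2$ and $R-\widetilde R<\frac1K\sum_{k=1}^K\gamma_k^{-1}$.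 2. Almost surely, $\widetilde R-\bigl(R_{\mathrm{Ideal}}-\Delta R_{\mathrm{BS}}-\Delta R_{\mathrm{UE}}\bigr)\to0$ as $K\to\infty$ through the numbers of users for which all SINDRs are positive (in particular through those for which all of them exceed $1$). Consequently, almost surely, $R-\bigl(R_{\mathrm{Ideal}}-\Delta R_{\mathrm{BS}}-\Delta R_{\mathrm{UE}}\bigr)\to0$ as $K\to\infty$ through any such numbers of users along which $\frac1K\sum_{k=1}^K\gamma_k^{-1}\to0$. -/

import Mathlib

open MeasureTheory ProbabilityTheory Filter Topology
open scoped Matrix NNReal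

noncomputable section

/-- Complementary error function. -/
def erfc (x : ℝ) : ℝ := 2 / √Real.pi * ∫ s in Set.Ioi x, Real.exp (-s ^ 2)

/-- Exponential integral `Ei`, used for negative arguments only. -/
def expEi (x : ℝ) : ℝ := ∫ s in Set.Iic x, s⁻¹ * Real.exp s

/-- The Bussgang gain `μ` of the solid state power amplifier. -/
def bussgangMu (x : ℝ) : ℝ :=
  x / 2 * (2 * x - √Real.pi * erfc x * Real.exp (x ^ 2) * (2 * x ^ 2 - 1))

/-- The distortion power `λ` of an amplifier of saturation level `A` and unit small-signal gain,
for an input of standard deviation `x`. -/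
def distortionLambda (A x : ℝ) : ℝ :=
  A ^ 2 + A ^ 4 / x ^ 2 * Real.exp (A ^ 2 / x ^ 2) * expEi (-(A ^ 2 / x ^ 2))
    - x ^ 2 * bussgangMu (A / x) ^ 2

/-- The relative gain `v / (1 + (|x| / B) ^ (2p)) ^ (1 / (2p))` of a user's power amplifier, with
small-signal factor `v`, saturation level `B`, smoothness `p` and input `x`. -/
def ueGain (p B : ℝ) (v x : ℂ) : ℂ :=
  v / (((1 + (‖x‖ / B) ^ (2 * p)) ^ (1 / (2 * p)) : ℝ) : ℂ)

/-- The law of `exp Z` with `Z ∼ N(0, δ²)`. -/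
def logNormal (δ : ℝ≥0) : Measure ℝ := (gaussianReal 0 (δ ^ 2)).map Real.exp

/-- The numerical data of one realization of a downlink with `M` base station antennas and `K`
single-antenna users. -/
structure Downlink (M K : ℕ) where
  /-- small-signal gain of the base station amplifiers -/
  a₀ : ℝ
  /-- average transmit power of the base station -/
  ρ : ℝ
  /-- standard deviation of the receiver noise -/
  σn : ℝ
  /-- common saturation level of the base station amplifiers -/
  Asat : ℝ
  /-- relative saturation levels -/
  a : Fin M → ℝ
  /-- relative small-signal transmit gains of the base station -/
  t : Fin M → ℂ
  /-- receive gains of the base station -/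
  r : Fin M → ℂ
  /-- large-scale path losses -/
  φ : Fin K → ℝ
  /-- receive gains of the users -/
  u : Fin K → ℂ
  /-- relative transmit gains of the users -/
  b : Fin K → ℂ

/-- `tr {Φ⁻²}` -/
def trPhi {K : ℕ} (φ : Fin K → ℝ) : ℝ := ((Matrix.diagonal φ ^ 2)⁻¹).trace

/-- `tr {(𝓑 𝓑*)⁻¹}` -/
def trB {K : ℕ} (b : Fin K → ℂ) : ℝ :=
  ((Matrix.diagonal b * (Matrix.diagonal b)ᴴ)⁻¹).trace.re

/-- The ideal rate of the downlink. -/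
def rateIdeal (M : ℕ) {K : ℕ} (φ : Fin K → ℝ) (ρ a₀ σn : ℝ) : ℝ :=
  Real.log (((M : ℝ) - K) / trPhi φ * (ρ * a₀ / σn ^ 2))

/-- The rate loss due to the user side. -/
def rateLossUE {K : ℕ} (b u : Fin K → ℂ) : ℝ :=
  1 / (K : ℝ) * ∑ k, Real.log (‖b k‖ ^ 2 / (K * ‖u k‖ ^ 2) * trB b)

namespace Downlink

variable {M K : ℕ} (S : Downlink M K)

/-- `R = diag (r₁, …, r_M)` -/
def matR : Matrix (Fin M) (Fin M) ℂ := Matrix.diagonal S.r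

/-- `𝓑 = diag (b₁, …, b_K)` -/
def matB : Matrix (Fin K) (Fin K) ℂ := Matrix.diagonal S.b

/-- `Φ = diag (φ₁, …, φ_K)` -/
def matPhi : Matrix (Fin K) (Fin K) ℂ := Matrix.diagonal fun k => (S.φ k : ℂ)

/-- `tr {R R*}` -/
def trRR : ℝ := (S.matR * S.matRᴴ).trace.re

/-- `G = diag (g₁, …, g_M)`, the Bussgang gains of the base station under zero forcing. -/
def matG : Matrix (Fin M) (Fin M) ℂ := Matrix.diagonal fun m =>
  S.t m * (bussgangMu (S.Asat * S.a m * √S.trRR / √(‖S.r m‖ ^ 2 * S.ρ)) : ℂ)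

/-- `Σ = diag (σ₁², …, σ_M²)`, the distortion variances under zero forcing. -/
def matSigma : Matrix (Fin M) (Fin M) ℝ := Matrix.diagonal fun m =>
  ‖S.t m‖ ^ 2 * distortionLambda (S.Asat * S.a m) (√(‖S.r m‖ ^ 2 * S.ρ / S.trRR))

/-- `α = tr {R⁻¹ G} / M` -/
def alpha : ℂ := 1 / (M : ℂ) * (S.matR⁻¹ * S.matG).trace

/-- `tr {(G - α R) (G - α R)*}` -/
def trMismatch : ℝ :=
  ((S.matG - S.alpha • S.matR) * (S.matG - S.alpha • S.matR)ᴴ).trace.re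

/-- `tr {(𝓑 Φ² 𝓑*)⁻¹}` -/
def trBPhi : ℝ := ((S.matB * S.matPhi ^ 2 * S.matBᴴ)⁻¹).trace.re

/-- Power of the effective signal. -/
def powES (k : Fin K) : ℝ :=
  S.a₀ * S.ρ * ((M : ℝ) - K) * ‖S.u k * (S.matG * S.matRᴴ).trace‖ ^ 2 /
    (M * ‖S.b k‖ ^ 2 * S.trBPhi * S.trRR)

/-- Power of the self-interference. -/
def powSI (k : Fin K) : ℝ :=
  S.a₀ * S.ρ * ‖S.u k‖ ^ 2 * S.trMismatch /
    (((M : ℝ) - K)⁻¹ * (M : ℝ) ^ 2 * ‖S.b k‖ ^ 2 * S.trBPhi)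

/-- Power of the multi-user interference. -/
def powMUI (k : Fin K) : ℝ :=
  ∑ i ∈ Finset.univ.erase k, S.a₀ * S.ρ * S.φ k ^ 2 * S.trMismatch /
    (((M : ℝ) - K)⁻¹ * (M : ℝ) ^ 2 * ‖(S.u k)⁻¹ * S.b i‖ ^ 2 * S.φ i ^ 2 * S.trBPhi)

/-- Power of the nonlinear distortion. -/
def powNLD (k : Fin K) : ℝ := S.a₀ * ‖S.u k‖ ^ 2 * S.φ k ^ 2 * S.matSigma.trace

/-- The closed-form SINDR of the `k`-th user. -/
def sindr (k : Fin K) : ℝ :=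
  S.powES k / (S.powSI k + S.powMUI k + S.powNLD k + S.σn ^ 2)

/-- The average achievable rate `R`, in nats. -/
def rate : ℝ := 1 / (K : ℝ) * ∑ k, Real.log (1 + S.sindr k)

/-- The average of `log γ_k`, which replaces that of `log (1 + γ_k)` for SINDRs above one. -/
def rateHigh : ℝ := 1 / (K : ℝ) * ∑ k, Real.log (S.sindr k)

/-- `ε₂` -/
def eps2 : ℝ := S.trMismatch / M

/-- `σ_{eq,k}²` -/
def sigmaEq (k : Fin K) : ℝ :=
  S.a₀ * S.φ k ^ 2 * S.matSigma.trace + S.σn ^ 2 / ‖S.u k‖ ^ 2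

/-- The rate loss due to the base station side. -/
def rateLossBS : ℝ :=
  1 / (K : ℝ) * ∑ k, Real.log
    ((((M : ℝ) - K) / M * S.ρ * S.a₀ * S.φ k ^ 2 * S.eps2 + S.sigmaEq k) /
      (1 / (M : ℝ) * S.σn ^ 2 * ‖(S.matG * S.matRᴴ).trace‖ ^ 2 * (S.trRR)⁻¹))

/-- `R_Ideal - ΔR_BS - ΔR_UE` -/
def rateSplit : ℝ :=
  rateIdeal M S.φ S.ρ S.a₀ S.σn - S.rateLossBS - rateLossUE S.b S.u

end Downlink

end

/-! The self-interference is exactly the missing term `i = k` of the multi-user interference, so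
their sum contains the full trace `trBPhi`, which cancels. Hence, once the SINDRs are nonzero, the
gap `rateHigh - rateSplit` is explicit (`rateHigh_sub_rateSplit`): the log of (mean of `φ⁻²`)(mean
of `|b|⁻²`)/(mean of `φ⁻²|b|⁻²`), minus twice the mean of `log |u|`. All base-station quantities
drop out, which is why they may be arbitrary.

The mean of `log |u|` tends to zero by the strong law for centered Gaussians. The first term needs a
strong law with the weights `φ⁻²` (`ae_tendsto_weighted_average`). As `|b|⁻²` is only integrable, no
variance bound is available; instead the weights are quantized, which reduces the claim to the
ordinary strong law along subsets of indices. -/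

theorem sum_range_filter_eq_sum_nth (p : ℕ → Prop) [DecidablePred p] (g : ℕ → ℝ) (n : ℕ) :
    ∑ k ∈ Finset.range n, (if p k then g k else 0) =
      ∑ i ∈ Finset.range (Nat.count p n), g (Nat.nth p i) := by
  induction n with
  | zero => simp
  | succ n ih =>
    rw [Finset.sum_range_succ, ih, Nat.count_succ]
    by_cases h : p n
    · simp [h, Finset.sum_range_succ, Nat.nth_count h]
    · simp [h]

theorem tendsto_count_atTop {p : ℕ → Prop} [DecidablePred p] (hp : {k | p k}.Infinite) :
    Tendsto (Nat.count p) atTop atTop :=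
  tendsto_atTop_atTop_of_monotone (Nat.count_monotone p)
    fun n => ⟨Nat.nth p n, (Nat.count_nth_of_infinite hp n).ge⟩

theorem tendsto_zero_of_abs_le {g h : ℕ → ℝ} (hgh : ∀ n, |g n| ≤ |h n|)
    (hh : Tendsto h atTop (𝓝 0)) : Tendsto g atTop (𝓝 0) :=
  squeeze_zero_norm hgh (by simpa using hh.abs)

/-! ### Strong laws with restricted indices and with bounded weights -/

section StrongLaw

variable {Ω : Type*} [MeasurableSpace Ω] {P : Measure Ω} {X : ℕ → Ω → ℝ}

/-- The strong law of large numbers along an arbitrary set of indices. -/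
theorem ae_tendsto_average_restrict (hint : Integrable (X 0) P)
    (hindep : Pairwise fun i j => X i ⟂ᵢ[P] X j) (hident : ∀ i, IdentDistrib (X i) (X 0) P P)
    (hmean : ∫ ω, X 0 ω ∂P = 0) (p : ℕ → Prop) [DecidablePred p] :
    ∀ᵐ ω ∂P, Tendsto (fun n : ℕ => (∑ k ∈ Finset.range n, if p k then X k ω else 0) / n)
      atTop (𝓝 0) := by
  by_cases hp : {k | p k}.Infinite
  · have hinj : Function.Injective (Nat.nth p) := Nat.nth_injective hp
    have hslln := strong_law_ae_real (fun i => X (Nat.nth p i))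
      ((hident _).integrable_iff.2 hint) (fun i j hij => hindep (hinj.ne hij))
      (fun i => (hident _).trans (hident _).symm)
    filter_upwards [hslln] with ω hω
    rw [(hident _).integral_eq, hmean] at hω
    refine tendsto_zero_of_abs_le (fun n => ?_) (hω.comp (tendsto_count_atTop hp))
    -- Both sides have the same numerator; dividing by `n` instead of by the count, which is at most
    -- `n`, only shrinks the quotient.
    rw [sum_range_filter_eq_sum_nth p (fun k => X k ω), Function.comp_apply, abs_div, abs_div,
      Nat.abs_cast, Nat.abs_cast]
    rcases (Nat.count p n).eq_zero_or_pos with h | h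
    · simp [h]
    · gcongr
      exact Nat.count_le p
  · refine .of_forall fun ω => ?_
    have hs : Summable fun k => if p k then X k ω else 0 :=
      summable_of_hasFiniteSupport ((Set.not_infinite.1 hp).subset fun k hk => by
        by_contra h
        exact hk (if_neg h))
    exact hs.hasSum.tendsto_sum_nat.div_atTop tendsto_natCast_atTop_atTop

/-- The strong law of large numbers for centered variables with bounded weights. -/
theorem ae_tendsto_weighted_average (hint : Integrable (X 0) P)
    (hindep : Pairwise fun i j => X i ⟂ᵢ[P] X j) (hident : ∀ i, IdentDistrib (X i) (X 0) P P)
    (hmean : ∫ ω, X 0 ω ∂P = 0) {w : ℕ → ℝ} {W : ℝ} (hw₀ : ∀ k, 0 ≤ w k) (hw : ∀ k, w k ≤ W) :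
    ∀ᵐ ω ∂P, Tendsto (fun n : ℕ => (∑ k ∈ Finset.range n, w k * X k ω) / n) atTop (𝓝 0) := by
  have habs := strong_law_ae_real (fun k ω => |X k ω|) hint.abs
    (fun i j hij => (hindep hij).comp measurable_norm measurable_norm)
    (fun i => (hident i).norm)
  have hlevel : ∀ᵐ ω ∂P, ∀ m j : ℕ,
      Tendsto (fun n : ℕ => (∑ k ∈ Finset.range n,
        if j < ⌊w k * (m + 1)⌋₊ then X k ω else 0) / n) atTop (𝓝 0) :=
    ae_all_iff.2 fun m => ae_all_iff.2 fun j =>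
      ae_tendsto_average_restrict hint hindep hident hmean fun k => j < ⌊w k * ((m : ℝ) + 1)⌋₊
  filter_upwards [habs, hlevel] with ω hω hlev
  set L := ∫ ω, |X 0 ω| ∂P
  have hL : 0 ≤ L := integral_nonneg fun _ => abs_nonneg _
  -- Layer-cake decomposition: an integer weight `N` is the number of `j < N`, so the sum with
  -- integer weights is a finite sum of restricted sums, one for each level `j`.
  have hfloor (m : ℕ) : Tendsto (fun n : ℕ => (∑ k ∈ Finset.range n,
      (⌊w k * (m + 1)⌋₊ : ℝ) * X k ω) / n) atTop (𝓝 0) := by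
    have hsum := tendsto_finsetSum (Finset.range ⌊W * (m + 1)⌋₊) fun j _ => hlev m j
    rw [Finset.sum_const_zero] at hsum
    refine hsum.congr fun n => ?_
    rw [← Finset.sum_div, Finset.sum_comm]
    congr 1
    refine Finset.sum_congr rfl fun k _ => ?_
    have hle : ⌊w k * ((m : ℝ) + 1)⌋₊ ≤ ⌊W * ((m : ℝ) + 1)⌋₊ :=
      Nat.floor_mono (by gcongr; exact hw k)
    rw [← Finset.sum_filter, Finset.sum_const, nsmul_eq_mul]
    congr 2
    rw [show (Finset.range ⌊W * ((m : ℝ) + 1)⌋₊).filter (fun j => j < ⌊w k * ((m : ℝ) + 1)⌋₊) =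
      Finset.range ⌊w k * ((m : ℝ) + 1)⌋₊ by ext j; simp; omega, Finset.card_range]
  rw [Metric.tendsto_atTop']
  refine fun ε hε => ?_
  -- After scaling by `m + 1`, the integer parts of the weights contribute less than `1`, and the
  -- fractional parts less than `L + 1`.
  obtain ⟨m, hm⟩ := exists_nat_gt ((L + 2) / ε)
  have hm0 : (0 : ℝ) < m + 1 := by positivity
  have hmε : L + 2 < ε * (m + 1) := by
    rw [div_lt_iff₀ hε] at hm
    nlinarith
  have hev : ∀ᶠ n : ℕ in atTop, |(∑ k ∈ Finset.range n, w k * X k ω) / n| < ε := by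
    filter_upwards [hω.eventually_lt_const (lt_add_one L),
      (hfloor m).abs.eventually_lt_const (by simp : |(0 : ℝ)| < 1)] with n h₁ h₂
    have hdiff : |∑ k ∈ Finset.range n, (w k * (m + 1) - ⌊w k * (m + 1)⌋₊) * X k ω| ≤
        ∑ k ∈ Finset.range n, |X k ω| := by
      refine (Finset.abs_sum_le_sum_abs _ _).trans (Finset.sum_le_sum fun k _ => ?_)
      rw [abs_mul]
      refine mul_le_of_le_one_left (abs_nonneg _) (abs_le.2 ⟨?_, ?_⟩)
      · linarith [Nat.floor_le (mul_nonneg (hw₀ k) hm0.le)]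
      · linarith [Nat.lt_floor_add_one (w k * ((m : ℝ) + 1))]
    have hsplit : (m + 1) * ((∑ k ∈ Finset.range n, w k * X k ω) / n) =
        (∑ k ∈ Finset.range n, (⌊w k * (m + 1)⌋₊ : ℝ) * X k ω) / n +
        (∑ k ∈ Finset.range n, (w k * (m + 1) - ⌊w k * (m + 1)⌋₊) * X k ω) / n := by
      rw [← add_div, ← Finset.sum_add_distrib, ← mul_div_assoc, Finset.mul_sum]
      congr 1
      exact Finset.sum_congr rfl fun k _ => by ring
    have hlast : |(∑ k ∈ Finset.range n, (w k * (m + 1) - ⌊w k * (m + 1)⌋₊) * X k ω) / n| ≤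
        (∑ k ∈ Finset.range n, |X k ω|) / n := by
      rw [abs_div, Nat.abs_cast]
      gcongr
    have hbound : (m + 1) * |(∑ k ∈ Finset.range n, w k * X k ω) / n| < (m + 1) * ε := by
      rw [← abs_of_pos hm0, ← abs_mul, abs_of_pos hm0, hsplit]
      refine (abs_add_le _ _).trans_lt ?_
      linarith
    exact lt_of_mul_lt_mul_left hbound hm0.le
  obtain ⟨N, hN⟩ := eventually_atTop.1 hev
  exact ⟨N, fun n hn => by
    rw [Real.dist_eq, sub_zero]
    exact hN n hn.le⟩

end StrongLaw

/-! ### Traces of diagonal matrices as sums -/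

theorem inv_diagonal_of_ne_zero {n 𝕜 : Type*} [Fintype n] [DecidableEq n] [Field 𝕜] {d : n → 𝕜}
    (hd : ∀ i, d i ≠ 0) : (Matrix.diagonal d)⁻¹ = Matrix.diagonal fun i => (d i)⁻¹ := by
  refine Matrix.inv_eq_left_inv ?_
  rw [Matrix.diagonal_mul_diagonal, ← Matrix.diagonal_one]
  congr 1
  exact funext fun i => inv_mul_cancel₀ (hd i)

theorem trPhi_eq_sum {K : ℕ} {φ : Fin K → ℝ} (hφ : ∀ k, φ k ≠ 0) :
    trPhi φ = ∑ k, (φ k ^ 2)⁻¹ := by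
  rw [trPhi, Matrix.diagonal_pow, inv_diagonal_of_ne_zero (by simpa using hφ),
    Matrix.trace_diagonal]
  rfl

theorem Complex.mul_star_self_eq (z : ℂ) : z * star z = ((‖z‖ ^ 2 : ℝ) : ℂ) := by
  rw [Complex.star_def, Complex.mul_conj, Complex.normSq_eq_norm_sq]

theorem trB_eq_sum {K : ℕ} {b : Fin K → ℂ} (hb : ∀ k, b k ≠ 0) :
    trB b = ∑ k, (‖b k‖ ^ 2)⁻¹ := by
  have h : Matrix.diagonal b * (Matrix.diagonal b)ᴴ =
      Matrix.diagonal fun k => ((‖b k‖ ^ 2 : ℝ) : ℂ) := by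
    rw [Matrix.diagonal_conjTranspose, Matrix.diagonal_mul_diagonal]
    exact congrArg _ (funext fun k => Complex.mul_star_self_eq _)
  rw [trB, h, inv_diagonal_of_ne_zero (by simpa using hb), Matrix.trace_diagonal, Complex.re_sum]
  exact Finset.sum_congr rfl fun k _ => by rw [← Complex.ofReal_inv, Complex.ofReal_re]

namespace Downlink

variable {M K : ℕ} {S : Downlink M K}

theorem trBPhi_eq_sum (hb : ∀ k, S.b k ≠ 0) (hφ : ∀ k, S.φ k ≠ 0) :
    S.trBPhi = ∑ k, (‖S.b k‖ ^ 2 * S.φ k ^ 2)⁻¹ := by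
  have h : S.matB * S.matPhi ^ 2 * S.matBᴴ =
      Matrix.diagonal fun k => ((‖S.b k‖ ^ 2 * S.φ k ^ 2 : ℝ) : ℂ) := by
    rw [matB, matPhi, Matrix.diagonal_pow, Matrix.diagonal_conjTranspose,
      Matrix.diagonal_mul_diagonal, Matrix.diagonal_mul_diagonal]
    refine congrArg _ (funext fun k => ?_)
    rw [mul_right_comm, Pi.star_apply, Complex.mul_star_self_eq]
    simp
  rw [trBPhi, h, inv_diagonal_of_ne_zero, Matrix.trace_diagonal, Complex.re_sum]
  · exact Finset.sum_congr rfl fun k _ => by rw [← Complex.ofReal_inv, Complex.ofReal_re]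
  · intro k
    have h₁ := norm_ne_zero_iff.2 (hb k)
    have h₂ := hφ k
    exact Complex.ofReal_ne_zero.2 (by positivity)

/-! ### The exact gap of the splitting -/

/-- The noise and distortion power of a user, relative to its squared receive gain. -/
noncomputable def noiseRel (S : Downlink M K) (k : Fin K) : ℝ :=
  ((M : ℝ) - K) / M * S.ρ * S.a₀ * S.φ k ^ 2 * S.eps2 + S.sigmaEq k

/-- Each quantity is a factor of the numerator or of the denominator, and division by zero gives
zero. A nonzero SINDR thus supplies every nondegeneracy that the cancellations need. -/
theorem ne_zero_of_powES_ne_zero {k : Fin K} (h : S.powES k ≠ 0) :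
    S.a₀ ≠ 0 ∧ S.ρ ≠ 0 ∧ (M : ℝ) - K ≠ 0 ∧ (M : ℝ) ≠ 0 ∧ S.u k ≠ 0 ∧ S.b k ≠ 0 ∧
      S.trBPhi ≠ 0 ∧ S.trRR ≠ 0 ∧ (S.matG * S.matRᴴ).trace ≠ 0 := by
  refine ⟨?_, ?_, ?_, ?_, ?_, ?_, ?_, ?_, ?_⟩ <;> intro h0 <;> apply h <;> simp [powES, h0]

/-- The self-interference is the missing term of the multi-user interference. -/
theorem powSI_add_powMUI (hb : ∀ k, S.b k ≠ 0) (hφ : ∀ k, S.φ k ≠ 0) (hβ : S.trBPhi ≠ 0)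
    (k : Fin K) : S.powSI k + S.powMUI k =
      ‖S.u k‖ ^ 2 * (((M : ℝ) - K) / M * S.ρ * S.a₀ * S.φ k ^ 2 * S.eps2) := by
  set f : Fin K → ℝ := fun i => S.a₀ * S.ρ * S.φ k ^ 2 * S.trMismatch /
    (((M : ℝ) - K)⁻¹ * (M : ℝ) ^ 2 * ‖(S.u k)⁻¹ * S.b i‖ ^ 2 * S.φ i ^ 2 * S.trBPhi) with hf
  set c : ℝ := ‖S.u k‖ ^ 2 * S.a₀ * S.ρ * S.φ k ^ 2 * S.trMismatch * ((M : ℝ) - K) *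
    ((M : ℝ) ^ 2)⁻¹ with hc
  have hfi (i : Fin K) : f i = c * (S.trBPhi)⁻¹ * (‖S.b i‖ ^ 2 * S.φ i ^ 2)⁻¹ := by
    simp only [hf, hc, norm_mul, norm_inv, div_eq_mul_inv, mul_inv, mul_pow, inv_pow, inv_inv]
    ring
  -- At `i = k` the path losses `φ k ^ 2` and `φ i ^ 2` cancel.
  have hSI : S.powSI k = f k := by
    have := hφ k
    rw [hfi, powSI, hc]
    simp only [div_eq_mul_inv, mul_inv, inv_inv]
    field_simp
  rw [hSI, powMUI, Finset.add_sum_erase _ f (Finset.mem_univ k)]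
  simp_rw [hfi]
  rw [← Finset.mul_sum, ← trBPhi_eq_sum hb hφ, inv_mul_cancel_right₀ hβ, hc, eps2]
  simp only [div_eq_mul_inv]
  ring

theorem sindr_eq (hb : ∀ k, S.b k ≠ 0) (hφ : ∀ k, S.φ k ≠ 0) (hβ : S.trBPhi ≠ 0) {k : Fin K}
    (hu : S.u k ≠ 0) : S.sindr k = S.powES k / (‖S.u k‖ ^ 2 * S.noiseRel k) := by
  have hu' := norm_ne_zero_iff.2 hu
  rw [sindr, powSI_add_powMUI hb hφ hβ, powNLD, noiseRel, sigmaEq]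
  congr 1
  field_simp
  ring

/-- The gap of the splitting for nonzero SINDRs. -/
theorem rateHigh_sub_rateSplit (hK : K ≠ 0) (hσ : S.σn ≠ 0) (hφ : ∀ k, S.φ k ≠ 0)
    (hγ : ∀ k, S.sindr k ≠ 0) :
    S.rateHigh - S.rateSplit =
      Real.log (trPhi S.φ / K * (trB S.b / K) / (S.trBPhi / K)) -
        1 / (K : ℝ) * ∑ k, 2 * Real.log ‖S.u k‖ := by
  have hES (k) : S.powES k ≠ 0 := fun h => hγ k (by simp [sindr, h])
  have hb (k) : S.b k ≠ 0 := (ne_zero_of_powES_ne_zero (hES k)).2.2.2.2.2.1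
  have hu (k) : S.u k ≠ 0 := (ne_zero_of_powES_ne_zero (hES k)).2.2.2.2.1
  have hne : Nonempty (Fin K) := ⟨⟨0, Nat.pos_of_ne_zero hK⟩⟩
  obtain ⟨k₀⟩ := id hne
  obtain ⟨ha, hρ, hMK, hM, -, -, hβ, hRR, hG⟩ := ne_zero_of_powES_ne_zero (hES k₀)
  have hK' : (K : ℝ) ≠ 0 := Nat.cast_ne_zero.2 hK
  have hPhi : trPhi S.φ ≠ 0 := by
    rw [trPhi_eq_sum hφ]
    exact (Finset.sum_pos (fun k _ => by have := hφ k; positivity) Finset.univ_nonempty).ne'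
  have hB : trB S.b ≠ 0 := by
    rw [trB_eq_sum hb]
    exact (Finset.sum_pos (fun k _ => by have := hb k; positivity) Finset.univ_nonempty).ne'
  have hG' : ‖(S.matG * S.matRᴴ).trace‖ ≠ 0 := norm_ne_zero_iff.2 hG
  have hterm (k : Fin K) : Real.log (S.sindr k) =
      Real.log (((M : ℝ) - K) / trPhi S.φ * (S.ρ * S.a₀ / S.σn ^ 2)) -
      Real.log (S.noiseRel k /
        (1 / (M : ℝ) * S.σn ^ 2 * ‖(S.matG * S.matRᴴ).trace‖ ^ 2 * (S.trRR)⁻¹)) -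
      Real.log (‖S.b k‖ ^ 2 / (K * ‖S.u k‖ ^ 2) * trB S.b) +
      Real.log (trPhi S.φ / K * (trB S.b / K) / (S.trBPhi / K)) - 2 * Real.log ‖S.u k‖ := by
    have hu' := norm_ne_zero_iff.2 (hu k)
    have hb' := norm_ne_zero_iff.2 (hb k)
    -- A zero denominator would make the SINDR zero.
    have hD : S.noiseRel k ≠ 0 := fun h => hγ k (by rw [sindr_eq hb hφ hβ (hu k), h]; simp)
    rw [show 2 * Real.log ‖S.u k‖ = Real.log (‖S.u k‖ ^ 2) by rw [Real.log_pow]; norm_num,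
      ← Real.log_div (by positivity) (by positivity),
      ← Real.log_div (by positivity) (by positivity),
      ← Real.log_mul (by positivity) (by positivity),
      ← Real.log_div (by positivity) (by positivity), sindr_eq hb hφ hβ (hu k), powES, norm_mul]
    congr 1
    field_simp
  have hconst (c : ℝ) : 1 / (K : ℝ) * ∑ _k : Fin K, c = c := by
    simp [hK']
  rw [rateHigh, rateSplit, rateLossBS, rateLossUE, rateIdeal, Finset.sum_congr rfl fun k _ => hterm k,
    Finset.sum_sub_distrib, Finset.sum_add_distrib, Finset.sum_sub_distrib,
    Finset.sum_sub_distrib, mul_sub, mul_add, mul_sub, mul_sub, hconst, hconst]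
  simp only [noiseRel]
  ring

/-! ### The cost of dropping the one in `log (1 + γ)` -/

theorem rate_sub_rateHigh (hγ : ∀ k, 0 < S.sindr k) :
    S.rate - S.rateHigh = 1 / (K : ℝ) * ∑ k, Real.log (1 + (S.sindr k)⁻¹) := by
  rw [rate, rateHigh, ← mul_sub, ← Finset.sum_sub_distrib]
  congr 1
  refine Finset.sum_congr rfl fun k _ => ?_
  have := hγ k
  rw [← Real.log_div (by positivity) this.ne']
  congr 1
  field_simp
  ring

theorem rate_sub_rateHigh_nonneg (hγ : ∀ k, 0 < S.sindr k) : 0 ≤ S.rate - S.rateHigh := by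
  rw [rate_sub_rateHigh hγ]
  refine mul_nonneg (by positivity) (Finset.sum_nonneg fun k _ => Real.log_nonneg ?_)
  linarith [inv_pos.2 (hγ k)]

theorem rate_sub_rateHigh_le (hγ : ∀ k, 0 < S.sindr k) :
    S.rate - S.rateHigh ≤ 1 / (K : ℝ) * ∑ k, (S.sindr k)⁻¹ := by
  rw [rate_sub_rateHigh hγ]
  gcongr with k
  have := inv_pos.2 (hγ k)
  linarith [Real.log_le_sub_one_of_pos (show 0 < 1 + (S.sindr k)⁻¹ by linarith)]

theorem rate_sub_rateHigh_bounds (hK : 1 ≤ K) (hγ : ∀ k, 1 < S.sindr k) :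
    0 < S.rate - S.rateHigh ∧ S.rate - S.rateHigh < Real.log 2 ∧
      S.rate - S.rateHigh < 1 / (K : ℝ) * ∑ k, (S.sindr k)⁻¹ := by
  have hne : (Finset.univ : Finset (Fin K)).Nonempty := ⟨⟨0, hK⟩, Finset.mem_univ _⟩
  have hK' : (0 : ℝ) < K := by exact_mod_cast hK
  have hinv (k) : 0 < (S.sindr k)⁻¹ := inv_pos.2 (one_pos.trans (hγ k))
  rw [rate_sub_rateHigh fun k => one_pos.trans (hγ k)]
  refine ⟨?_, ?_, ?_⟩
  · exact mul_pos (by positivity)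
      (Finset.sum_pos (fun k _ => Real.log_pos (by linarith [hinv k])) hne)
  · calc 1 / (K : ℝ) * ∑ k, Real.log (1 + (S.sindr k)⁻¹)
        < 1 / (K : ℝ) * ∑ _k : Fin K, Real.log 2 := by
          refine mul_lt_mul_of_pos_left (Finset.sum_lt_sum_of_nonempty hne fun k _ => ?_)
            (by positivity)
          have := hinv k
          exact Real.log_lt_log (by linarith) (by linarith [inv_lt_one_of_one_lt₀ (hγ k)])
      _ = Real.log 2 := by simp [hK'.ne']
  · refine mul_lt_mul_of_pos_left (Finset.sum_lt_sum_of_nonempty hne fun k _ => ?_)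
      (by positivity)
    have := hinv k
    linarith [Real.log_lt_sub_one_of_pos (show 0 < 1 + (S.sindr k)⁻¹ by linarith)
      (by linarith)]

end Downlink

/-! ### Limits of the two terms of the gap -/

theorem ueGain_ne_zero {p B : ℝ} {v : ℂ} (x : ℂ) (hB : 0 < B) (hv : v ≠ 0) :
    ueGain p B v x ≠ 0 := by
  refine div_ne_zero hv (Complex.ofReal_ne_zero.2 (ne_of_gt ?_))
  positivity

/-- The mean of the logarithms of independent log-normal variables vanishes in the limit. -/
theorem ae_tendsto_average_log_logNormal {Ω : Type*} [MeasurableSpace Ω] {P : Measure Ω}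
    {X : ℕ → Ω → ℝ} {δ : ℝ≥0} (hlaw : ∀ k, HasLaw (X k) (logNormal δ) P)
    (hindep : iIndepFun X P) :
    ∀ᵐ ω ∂P, Tendsto (fun n : ℕ => (∑ k ∈ Finset.range n, Real.log (X k ω)) / n)
      atTop (𝓝 0) := by
  have hlog : HasLaw Real.log (gaussianReal 0 (δ ^ 2)) (logNormal δ) := by
    refine ⟨Real.measurable_log.aemeasurable, ?_⟩
    rw [logNormal, Measure.map_map Real.measurable_log Real.measurable_exp]
    simp [Function.comp_def]
  have hgauss (k) : HasLaw (Real.log ∘ X k) (gaussianReal 0 (δ ^ 2)) P := hlog.comp (hlaw k)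
  have hid : HasLaw id (gaussianReal 0 (δ ^ 2)) (gaussianReal 0 (δ ^ 2)) := HasLaw.id
  have hint : Integrable (Real.log ∘ X 0) P :=
    ((hgauss 0).identDistrib hid).integrable_iff.2
      (memLp_one_iff_integrable.1 (memLp_id_gaussianReal 1))
  have hmean : ∫ ω, (Real.log ∘ X 0) ω ∂P = 0 := by
    rw [((hgauss 0).identDistrib hid).integral_eq]
    exact integral_id_gaussianReal
  have := strong_law_ae_real (fun k => Real.log ∘ X k) hint
    (fun i j hij => (hindep.indepFun hij).comp Real.measurable_log Real.measurable_log)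
    (fun i => (hgauss i).identDistrib (hgauss 0))
  rwa [hmean] at this

/-- If the `w`-weighted and the plain averages of `Y` agree in the limit, averaging `w` and `Y`
separately changes the average of the product by a factor that tends to one. -/
theorem tendsto_log_average_mul_average_div {w Y : ℕ → ℝ} {m c : ℝ} (hm : 0 < m) (hc : 0 < c)
    (hw : ∀ k, m ≤ w k)
    (hY : Tendsto (fun n : ℕ => (∑ k ∈ Finset.range n, Y k) / n) atTop (𝓝 c))
    (hwY : Tendsto (fun n : ℕ => (∑ k ∈ Finset.range n, w k * (Y k - c)) / n) atTop (𝓝 0)) :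
    Tendsto (fun n : ℕ => Real.log ((∑ k ∈ Finset.range n, w k) / n *
      ((∑ k ∈ Finset.range n, Y k) / n) / ((∑ k ∈ Finset.range n, w k * Y k) / n)))
      atTop (𝓝 0) := by
  have hlow (n : ℕ) (hn : 0 < n) : m ≤ (∑ k ∈ Finset.range n, w k) / n := by
    rw [le_div_iff₀ (by positivity)]
    calc m * n = ∑ _k ∈ Finset.range n, m := by simp [mul_comm]
      _ ≤ _ := Finset.sum_le_sum fun k _ => hw k
  -- The `w`-weighted mean of `Y` is `c` plus this quotient, whose denominator is at least `m`. The
  -- log in the goal is minus that of the weighted mean over the plain mean, and both means tend to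
  -- `c`.
  have hquot : Tendsto (fun n : ℕ => (∑ k ∈ Finset.range n, w k * (Y k - c)) / n /
      ((∑ k ∈ Finset.range n, w k) / n)) atTop (𝓝 0) := by
    refine squeeze_zero_norm' ?_ (by simpa using hwY.norm.div_const m)
    filter_upwards [eventually_gt_atTop 0] with n hn
    have := hlow n hn
    rw [norm_div, Real.norm_of_nonneg (hm.le.trans this)]
    simp only [norm_div, Real.norm_eq_abs, RCLike.norm_natCast]
    gcongr
  have hlim : Tendsto (fun n : ℕ => -Real.log (((∑ k ∈ Finset.range n, w k * (Y k - c)) / n /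
      ((∑ k ∈ Finset.range n, w k) / n) + c) / ((∑ k ∈ Finset.range n, Y k) / n)))
      atTop (𝓝 0) := by
    have h := ((hquot.add_const c).div hY hc.ne').log (by simp [hc.ne'])
    simpa [hc.ne'] using h.neg
  refine hlim.congr' ?_
  filter_upwards [eventually_gt_atTop 0] with n hn
  have hpos := hm.trans_le (hlow n hn)
  have hsplit : (∑ k ∈ Finset.range n, w k * (Y k - c)) / n =
      (∑ k ∈ Finset.range n, w k * Y k) / n - c * ((∑ k ∈ Finset.range n, w k) / n) := by
    simp only [mul_sub, Finset.sum_sub_distrib, ← Finset.sum_mul]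
    ring
  rw [← Real.log_inv, hsplit, inv_div, sub_div, mul_div_cancel_right₀ _ hpos.ne',
    sub_add_cancel, div_div_eq_mul_div, mul_comm]

/-! ### The almost sure splitting -/

theorem proposition2 {Ω : Type*} [MeasurableSpace Ω] (P : Measure Ω) [IsProbabilityMeasure P]
    -- base station: `M K` antennas when there are `K` users
    (M : ℕ → ℕ) (hM : ∀ K, K < M K)
    (a₀ ρ σn Asat : ℝ) (ha₀ : 0 < a₀) (hρ : 0 < ρ) (hσn : 0 < σn) (hAsat : 0 < Asat)
    (a : ℕ → Ω → ℝ) (t r : ℕ → Ω → ℂ)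
    (ha : ∀ᵐ ω ∂P, ∀ m, 0 < a m ω) (hr : ∀ᵐ ω ∂P, ∀ m, r m ω ≠ 0)
    -- large-scale path losses, bounded above and away from zero
    (φ : ℕ → ℝ) (φmin φmax : ℝ) (hφmin : 0 < φmin) (hφ : ∀ k, φ k ∈ Set.Icc φmin φmax)
    -- receive gains of the users: independent log-normal amplitudes
    (u : ℕ → Ω → ℂ) (δu : ℝ≥0)
    (hu_law : ∀ k, HasLaw (fun ω => ‖u k ω‖) (logNormal δu) P)
    (hu_indep : iIndepFun (fun k ω => ‖u k ω‖) P)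
    -- transmit gains of the users: i.i.d. amplitudes with finite inverse second moment
    (p : ℝ) (hp : 0 < p) (Bsat : ℕ → Ω → ℝ) (v x : ℕ → Ω → ℂ)
    (hBsat : ∀ᵐ ω ∂P, ∀ k, 0 < Bsat k ω) (hv : ∀ᵐ ω ∂P, ∀ k, v k ω ≠ 0)
    (b : ℕ → Ω → ℂ) (hb : ∀ k ω, b k ω = ueGain p (Bsat k ω) (v k ω) (x k ω))
    (hb_indep : iIndepFun (fun k ω => ‖b k ω‖) P)
    (hb_ident : ∀ k, IdentDistrib (fun ω => ‖b k ω‖) (fun ω => ‖b 0 ω‖) P P)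
    (hb_int : Integrable (fun ω => (‖b 0 ω‖ ^ 2)⁻¹) P)
    -- the system with `K` users
    (S : (K : ℕ) → Ω → Downlink (M K) K)
    (hS : ∀ K ω, S K ω =
      { a₀ := a₀, ρ := ρ, σn := σn, Asat := Asat
        a := fun m => a m ω, t := fun m => t m ω, r := fun m => r m ω
        φ := fun k => φ k, u := fun k => u k ω, b := fun k => b k ω }) :
    -- replacing `log (1 + γ_k)` by `log γ_k`, when every SINDR exceeds one
    (∀ K ω, 1 ≤ K → (∀ k, 1 < (S K ω).sindr k) →
      0 < (S K ω).rate - (S K ω).rateHigh ∧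
      (S K ω).rate - (S K ω).rateHigh < Real.log 2 ∧
      (S K ω).rate - (S K ω).rateHigh < 1 / (K : ℝ) * ∑ k, ((S K ω).sindr k)⁻¹) ∧
    -- the splitting, as `K → ∞` through the numbers of users for which every SINDR is positive,
    -- in particular through those for which every SINDR exceeds one
    (∀ᵐ ω ∂P,
      Tendsto (fun K : ℕ => (S K ω).rateHigh - (S K ω).rateSplit)
        (atTop ⊓ 𝓟 {K : ℕ | ∀ k, 0 < (S K ω).sindr k}) (𝓝 0) ∧
      -- hence for the rate itself along any numbers of users for which the SINDRs are large
      (∀ F : Filter ℕ, F ≤ atTop ⊓ 𝓟 {K : ℕ | ∀ k, 0 < (S K ω).sindr k} →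
        Tendsto (fun K : ℕ => 1 / (K : ℝ) * ∑ k, ((S K ω).sindr k)⁻¹) F (𝓝 0) →
        Tendsto (fun K : ℕ => (S K ω).rate - (S K ω).rateSplit) F (𝓝 0))) := by
  refine ⟨fun K ω hK hγ => Downlink.rate_sub_rateHigh_bounds hK hγ, ?_⟩
  have hφ₀ (k : ℕ) : 0 < φ k := hφmin.trans_le (hφ k).1
  have hφmax : 0 < φmax := (hφ₀ 0).trans_le (hφ 0).2
  have hb₀ : ∀ᵐ ω ∂P, ∀ k, b k ω ≠ 0 := by
    filter_upwards [hBsat, hv] with ω hB hv k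
    rw [hb]
    exact ueGain_ne_zero _ (hB k) (hv k)
  set c := ∫ ω, (‖b 0 ω‖ ^ 2)⁻¹ ∂P with hc
  have hcpos : 0 < c := by
    refine (integral_pos_iff_support_of_nonneg (fun ω => by positivity) hb_int).2 ?_
    have hsupp : (Function.support fun ω => (‖b 0 ω‖ ^ 2)⁻¹) =ᵐ[P] Set.univ := by
      filter_upwards [hb₀] with ω hω
      refine propext (iff_of_true ?_ trivial)
      have := norm_pos_iff.2 (hω 0)
      exact (show 0 < (‖b 0 ω‖ ^ 2)⁻¹ by positivity).ne'
    rw [measure_congr hsupp]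
    simp
  have hsq : Measurable fun y : ℝ => (y ^ 2)⁻¹ := by fun_prop
  have hsqc : Measurable fun y : ℝ => (y ^ 2)⁻¹ - c := by fun_prop
  have hY : ∀ᵐ ω ∂P, Tendsto (fun n : ℕ => (∑ k ∈ Finset.range n, (‖b k ω‖ ^ 2)⁻¹) / n)
      atTop (𝓝 c) :=
    strong_law_ae_real (fun k ω => (‖b k ω‖ ^ 2)⁻¹) hb_int
      (fun i j hij => (hb_indep.indepFun hij).comp hsq hsq) (fun i => (hb_ident i).comp hsq)
  have hwY : ∀ᵐ ω ∂P, Tendsto (fun n : ℕ =>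
      (∑ k ∈ Finset.range n, (φ k ^ 2)⁻¹ * ((‖b k ω‖ ^ 2)⁻¹ - c)) / n) atTop (𝓝 0) := by
    refine ae_tendsto_weighted_average (X := fun k ω => (‖b k ω‖ ^ 2)⁻¹ - c)
      (W := (φmin ^ 2)⁻¹) (hb_int.sub (integrable_const c))
      (fun i j hij => (hb_indep.indepFun hij).comp hsqc hsqc) (fun i => (hb_ident i).comp hsqc)
      ?_ (fun k => by positivity) (fun k => ?_)
    · rw [integral_sub hb_int (integrable_const c)]
      simp [hc]
    · have := (hφ k).1
      gcongr
  have hmain : ∀ᵐ ω ∂P, Tendsto (fun K : ℕ => (S K ω).rateHigh - (S K ω).rateSplit)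
      (atTop ⊓ 𝓟 {K : ℕ | ∀ k, 0 < (S K ω).sindr k}) (𝓝 0) := by
    filter_upwards [hb₀, hY, hwY, ae_tendsto_average_log_logNormal hu_law hu_indep]
      with ω hbω hYω hwYω huω
    have hlog := tendsto_log_average_mul_average_div (m := (φmax ^ 2)⁻¹) (by positivity) hcpos
      (fun k => by have := (hφ k).2; have := hφ₀ k; gcongr) hYω hwYω
    have hlim := hlog.sub (huω.const_mul 2)
    rw [mul_zero, sub_zero] at hlim
    -- The explicit gap converges along all `K`; positivity of the SINDRs, a condition on `K` that
    -- depends on `ω`, serves only to identify it with `rateHigh - rateSplit`.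
    refine (hlim.mono_left inf_le_left).congr' ?_
    have hK : ∀ᶠ K : ℕ in atTop ⊓ 𝓟 {K : ℕ | ∀ k, 0 < (S K ω).sindr k}, K ≠ 0 :=
      (eventually_ne_atTop 0).filter_mono inf_le_left
    have hγ : ∀ᶠ K : ℕ in atTop ⊓ 𝓟 {K : ℕ | ∀ k, 0 < (S K ω).sindr k},
        ∀ k, 0 < (S K ω).sindr k := mem_inf_of_right (mem_principal_self _)
    filter_upwards [hK, hγ] with K hK hγ
    have hφS : (S K ω).φ = fun k : Fin K => φ k := by rw [hS]
    have hbS : (S K ω).b = fun k : Fin K => b k ω := by rw [hS]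
    have huS : (S K ω).u = fun k : Fin K => u k ω := by rw [hS]
    have hσS : (S K ω).σn = σn := by rw [hS]
    rw [Downlink.rateHigh_sub_rateSplit hK (hσS ▸ hσn.ne')
      (fun k => by rw [hφS]; exact (hφ₀ k).ne') fun k => (hγ k).ne',
      Downlink.trBPhi_eq_sum (fun k => by rw [hbS]; exact hbω k)
        (fun k => by rw [hφS]; exact (hφ₀ k).ne'),
      hφS, hbS, huS, trPhi_eq_sum fun k : Fin K => (hφ₀ k).ne', trB_eq_sum fun k : Fin K => hbω k,
      Fin.sum_univ_eq_sum_range fun k => (φ k ^ 2)⁻¹,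
      Fin.sum_univ_eq_sum_range fun k => (‖b k ω‖ ^ 2)⁻¹,
      Fin.sum_univ_eq_sum_range fun k => (‖b k ω‖ ^ 2 * φ k ^ 2)⁻¹,
      Fin.sum_univ_eq_sum_range fun k => 2 * Real.log ‖u k ω‖, ← Finset.mul_sum]
    simp only [mul_inv, mul_comm]
    ring
  filter_upwards [hmain] with ω hω
  refine ⟨hω, fun F hF hinv => ?_⟩
  have hγ : ∀ᶠ K in F, ∀ k, 0 < (S K ω).sindr k :=
    hF (mem_inf_of_right (mem_principal_self _))
  have hgap : Tendsto (fun K : ℕ => (S K ω).rate - (S K ω).rateHigh) F (𝓝 0) :=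
    tendsto_of_tendsto_of_tendsto_of_le_of_le' tendsto_const_nhds hinv
      (hγ.mono fun K h => Downlink.rate_sub_rateHigh_nonneg h)
      (hγ.mono fun K h => Downlink.rate_sub_rateHigh_le h)
  simpa using hgap.add (hω.mono_left hF)
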